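/- Let $\Bbbk$ be a field of characteristic zero, let $r\ge 1$, $\varepsilon\in\{0,\tfrac12\}$, let $n$ be an integer, put $d=n-2\varepsilon$, and assume $d>r+1$. Let $\mathbf V$ be an $n$-dimensional $\Bbbk$-vector space with basis $\mathbf v_1,\dots,\mathbf v_n$, and let $W_n\cong\mathrm{Sym}_n$ act on $\mathbf V^{\otimes r}$ by $w(\mathbf v_{j_1}\otimes\cdots\otimes\mathbf v_{j_r})=\mathbf v_{w(j_1)}\otimes\cdots\otimes\mathbf v_{w(j_r)}$. Let $W_{n-1}=\{w\in W_n\mid w(n)=n\}$ act on $\mathbf V^{\otimes r}$ by restriction (equivalently, on $\mathbf V^{\otimes r}\otimes\mathbf v_n\subset\mathbf V^{\otimes(r+1)}$). Identify $W_d$ with $\mathrm{Sym}_d$ and write $\Phi_{n,r+\varepsilon}:\Bbbk W_d\to\mathrm{End}_\Bbbk(\mathbf V^{\otimes r})$ for the resulting representation (of $\Bbbk W_n$ if $\varepsilon=0$, of $\Bbbk W_{n-1}$ if $\varepsilon=\tfrac12$). For $\lambda\vdash d$ let $M^\lambda=\mathrm{ind}_{\mathrm{Sym}_\lambda}^{\mathrm{Sym}_d}\Bbbk$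 be the permutation module induced from the trivial module of the Young subgroup $\mathrm{Sym}_\lambda$, let $S^\lambda\subseteq M^\lambda$ be the Specht module (spanned by the polytabloids), let $\trianglerighteq$ be the dominance order, and let $\alpha(d,r)=(d-r,1^r)$. Then: (a) $\ker\Phi_{n,r+\varepsilon}$ is isomorphic, as a (non-unital) $\Bbbk$-algebra, to $\bigoplus_{\lambda\vdash d,\ \lambda\not\trianglerighteq\alpha(d,r)}\mathrm{End}_\Bbbk(S^\lambda)$; an isomorphism is given by sending $a\in\ker\Phi_{n,r+\varepsilon}$ to the family of its actions on the modules $S^\lambda$. (b) $\ker\Phi_{n,r+\varepsilon}=\mathrm{ann}_{\Bbbk W_d}M^{\alpha(d,r)}=\bigcap_{\lambda\vdash d,\ \lambda\trianglerighteq\alpha(d,r)}\mathrm{ann}_{\Bbbk W_d}M^\lambda$. -/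

import Mathlib

namespace SymTensor

noncomputable section

/-! ### Partitions, Young subgroups and permutation modules -/

/-- The weakly decreasing sequence of the parts of a partition, as a composition. -/
def toComposition {d : ℕ} (p : Nat.Partition d) : Composition d where
  blocks := p.parts.sort (· ≥ ·)
  blocks_pos := fun h => p.parts_pos ((Multiset.mem_sort (· ≥ ·)).1 h)
  blocks_sum := by
    rw [← Multiset.sum_coe, Multiset.sort_eq, p.parts_sum]

/-- Dominance order: `Dominates p q` means `p ⊵ q`, that is
`p₁ + ⋯ + pᵢ ≥ q₁ + ⋯ + qᵢ` for every `i`. -/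
def Dominates {d : ℕ} (p q : Nat.Partition d) : Prop :=
  ∀ i : ℕ, (toComposition q).sizeUpTo i ≤ (toComposition p).sizeUpTo i

/-- The hook partition `α(d,r) = (d - r, 1^r)` of `d`, for `r < d`. -/
def hook (d r : ℕ) (h : r < d) : Nat.Partition d where
  parts := (d - r) ::ₘ Multiset.replicate r 1
  parts_pos := by
    intro i hi
    rcases Multiset.mem_cons.1 hi with rfl | hi
    · omega
    · rw [Multiset.eq_of_mem_replicate hi]; exact Nat.one_pos
  parts_sum := by
    simp only [Multiset.sum_cons, Multiset.sum_replicate, smul_eq_mul, mul_one]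
    omega

/-- The row of the row-reading tableau of shape `c` in which the entry `j` stands
(entries, rows and columns are numbered from `0`). -/
def row {d : ℕ} (c : Composition d) (j : Fin d) : ℕ := c.index j

/-- The column of the row-reading tableau of shape `c` in which the entry `j` stands. -/
def col {d : ℕ} (c : Composition d) (j : Fin d) : ℕ := c.invEmbedding j

/-- The subgroup of all permutations that preserve each fibre of `f`. -/
def fibreStabilizer {d : ℕ} (f : Fin d → ℕ) : Subgroup (Equiv.Perm (Fin d)) where
  carrier := {w | ∀ j, f (w j) = f j}
  mul_mem' := fun {v w} hv hw j => (hv (w j)).trans (hw j)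
  one_mem' := fun _ => rfl
  inv_mem' := fun {w} hw j => by
    have h := hw (w⁻¹ j)
    have h' : w (w⁻¹ j) = j := w.apply_symm_apply j
    rw [h'] at h
    exact h.symm

/-- The Young subgroup `Sym_c`: the row stabilizer of the row-reading tableau of shape `c`. -/
def youngSubgroup {d : ℕ} (c : Composition d) : Subgroup (Equiv.Perm (Fin d)) :=
  fibreStabilizer (row c)

/-- The column stabilizer of the row-reading tableau of shape `c`. -/
def columnSubgroup {d : ℕ} (c : Composition d) : Subgroup (Equiv.Perm (Fin d)) :=
  fibreStabilizer (col c)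

/-- The trivial representation of `Sym_c`, induced to `Sym_d`. -/
abbrev permRep (k : Type*) [CommRing k] {d : ℕ} (c : Composition d) :
    Representation k (Equiv.Perm (Fin d))
      (Representation.IndV (youngSubgroup c).subtype
        (Representation.trivial k (youngSubgroup c) k)) :=
  Representation.ind (youngSubgroup c).subtype (Representation.trivial k (youngSubgroup c) k)

/-- The permutation module `M^p`, a left module over the group algebra of `Sym_d`. -/
abbrev PermModule (k : Type*) [CommRing k] {d : ℕ} (p : Nat.Partition d) :=
  (permRep k (toComposition p)).asModule

/-- The canonical generator `1 ⊗ 1` of `M^p`, that is, the tabloid of the row-reading tableau. -/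
def tabloid (k : Type*) [CommRing k] {d : ℕ} (p : Nat.Partition d) : PermModule k p :=
  (permRep k (toComposition p)).asModuleEquiv.symm
    (Representation.IndV.mk (youngSubgroup (toComposition p)).subtype
      (Representation.trivial k (youngSubgroup (toComposition p)) k) 1 1)

open Classical in
/-- The signed column sum `∑ sgn(w) w`, over the column stabilizer of the row-reading tableau. -/
def columnAntisymmetrizer (k : Type*) [CommRing k] {d : ℕ} (p : Nat.Partition d) :
    MonoidAlgebra k (Equiv.Perm (Fin d)) :=
  ∑ w : Equiv.Perm (Fin d) with w ∈ columnSubgroup (toComposition p),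
    MonoidAlgebra.single w ((Equiv.Perm.sign w : ℤ) : k)

/-- The Specht module `S^p`: the submodule of `M^p` spanned by all polytabloids. Since
`w • e_t = e_{w t}`, it is the submodule generated by the polytabloid of the row-reading
tableau. -/
def Specht (k : Type*) [CommRing k] {d : ℕ} (p : Nat.Partition d) :
    Submodule (MonoidAlgebra k (Equiv.Perm (Fin d))) (PermModule k p) :=
  Submodule.span _ {columnAntisymmetrizer k p • tabloid k p}

/-- The algebra homomorphism `k Sym_d → End_k(S^p)`, `a ↦ (s ↦ a • s)`. -/
def spechtAction (k : Type*) [CommRing k] {d : ℕ} (p : Nat.Partition d) :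
    MonoidAlgebra k (Equiv.Perm (Fin d)) →ₐ[k] Module.End k (Specht k p) :=
  Algebra.lsmul k k (Specht k p)

/-! ### The action on tensor space -/

open scoped TensorProduct

/-- `W_n` permutes the given basis of `V`: `w • bᵢ = b_{w i}`. -/
def basisRep {k V : Type*} [CommRing k] [AddCommGroup V] [Module k V] {n : ℕ}
    (b : Module.Basis (Fin n) k V) : Representation k (Equiv.Perm (Fin n)) V where
  toFun w := (b.equiv b w).toLinearMap
  map_one' := by
    apply b.ext
    intro i
    simp
  map_mul' := by
    intro v w
    apply b.ext
    intro i
    simp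

/-- The diagonal action of `W_n` on the tensor power `V^{⊗ r}`. -/
def tensorRep {k V : Type*} [CommRing k] [AddCommGroup V] [Module k V] {n : ℕ}
    (b : Module.Basis (Fin n) k V) (r : ℕ) :
    Representation k (Equiv.Perm (Fin n)) (⨂[k] _ : Fin r, V) where
  toFun w := PiTensorProduct.map fun _ => basisRep b w
  map_one' := by
    simp only [map_one]
    exact PiTensorProduct.map_one
  map_mul' := by
    intro v w
    simp only [map_mul]
    exact PiTensorProduct.map_mul _ _

/-- The inclusion `W_d → W_{d+e}`; its image consists of the permutations that fix the last
`e` points. It is the identity for `e = 0`. -/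
def weylInclusion (d e : ℕ) : Equiv.Perm (Fin d) →* Equiv.Perm (Fin (d + e)) :=
  Equiv.Perm.viaEmbeddingHom (Fin.castAddEmb e)

/-- The representation `Φ_{n,r+ε} : k W_d → End_k(V^{⊗ r})`, where `n = d + 2ε` is the rank of
`V` and `e = 2ε`. For `e = 0` it is the action of `W_n`. For `e = 1` it is the restriction of
that action to `W_{n-1} = {w ∈ W_n | w(n) = n}`, which is the action of `W_{n-1}` on
`V^{⊗ r} ⊗ vₙ`, as `vₙ` is fixed. -/
def Phi {k V : Type*} [CommRing k] [AddCommGroup V] [Module k V] {d e : ℕ}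
    (b : Module.Basis (Fin (d + e)) k V) (r : ℕ) :
    MonoidAlgebra k (Equiv.Perm (Fin d)) →ₐ[k] Module.End k (⨂[k] _ : Fin r, V) :=
  Representation.asAlgebraHom ((tensorRep b r).comp (weylInclusion d e))

end

end SymTensor

open SymTensor

/-! Part (b) rests on a stabilizer computation. The tensor of the last `r` among the first `d` basis
vectors has as stabilizer in `W_d` exactly the Young subgroup of the hook, so the orbit of this
tensor spans a copy of the hook permutation module, and the kernel annihilates that module.
Conversely, a basis tensor involves at most `r` of the permuted indices, so it is a translate of a
tensor fixed by that Young subgroup, and the annihilator of the hook module kills it (`ker_Phi`). If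
`p` dominates the hook, its first part is at least `d - r`, so its Young subgroup contains that of
the hook; this gives the intersection formula.

Part (a) needs the Specht modules to be a complete family of matrix blocks. The column
antisymmetrizer `κ_p` kills `M^q` unless `p ⊵ q`, and maps `M^p` onto the line of the polytabloid.
Hence the ideal of `κ_p` induces every endomorphism of `S^p` (`exists_mem_idealSpan_smul_eq`, with a
Maschke argument). Triangularity for dominance then yields elements acting arbitrarily on one Specht
module and by zero on the others (`exists_smul_eq_single`). Comparing the number of partitions with
the dimension of the centre shows that an element killing every Specht module is zero
(`eq_zero_of_forall_smul_eq_zero`).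

The two parts meet in `mem_annihilator_of_forall_specht`: whether an element kills `M^q` is decided
by the `S^p` with `p ⊵ q`. The kernel is thus the set of elements vanishing on the `S^p` with `p`
dominating the hook, which is the product of the remaining blocks. -/

namespace SymTensor

/-! ### Sorting the columns of a diagram -/

section Diagram

variable {α : Type*} [Fintype α] {row col f : α → ℕ}

/-- A column that reaches row `i` has a cell in each row below `i`, while `f` takes distinct values
on the column, so at most `i` of them are below `i`. A shorter column is counted in full on the
right. -/
theorem card_column_lt_le (hdown : ∀ j, ∀ i < row j, ∃ j', row j' = i ∧ col j' = col j)
    (hf : Function.Injective fun j => (f j, col j)) (c i : ℕ) :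
    (Finset.univ.filter fun j => f j < i ∧ col j = c).card ≤
      (Finset.univ.filter fun j => row j < i ∧ col j = c).card := by
  by_cases h : ∃ j, col j = c ∧ i ≤ row j
  · obtain ⟨j, rfl, hj⟩ := h
    calc _ ≤ (Finset.range i).card := by
          refine Finset.card_le_card_of_injOn f (fun x hx => ?_) (fun x hx y hy hxy => ?_)
          · simpa using (Finset.mem_filter.1 hx).2.1
          · simp only [Finset.coe_filter, Finset.mem_univ, true_and, Set.mem_ofPred_eq] at hx hy
            exact hf (Prod.ext hxy (hx.2.trans hy.2.symm))
      _ ≤ ((Finset.univ.filter fun x => row x < i ∧ col x = col j).image row).card := by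
          refine Finset.card_le_card fun m hm => ?_
          have hm' := Finset.mem_range.1 hm
          obtain ⟨x, rfl, hx⟩ := hdown j m (by omega)
          exact Finset.mem_image.2 ⟨x, by simp [hx, hm'], rfl⟩
      _ ≤ _ := Finset.card_image_le
  · push Not at h
    refine Finset.card_le_card fun x hx => ?_
    simp only [Finset.mem_filter, Finset.mem_univ, true_and] at hx ⊢
    exact ⟨h x hx.2, hx.2⟩

theorem card_lt_eq_sum_columns (f col : α → ℕ) (i : ℕ) :
    (Finset.univ.filter fun j => f j < i).card =
      ∑ c ∈ Finset.univ.image col, (Finset.univ.filter fun j => f j < i ∧ col j = c).card := by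
  rw [Finset.card_eq_sum_card_fiberwise (f := col) (t := Finset.univ.image col) (by
    intro x _; simp)]
  simp only [Finset.filter_filter]

theorem card_lt_le (hdown : ∀ j, ∀ i < row j, ∃ j', row j' = i ∧ col j' = col j)
    (hf : Function.Injective fun j => (f j, col j)) (i : ℕ) :
    (Finset.univ.filter fun j => f j < i).card ≤
      (Finset.univ.filter fun j => row j < i).card := by
  rw [card_lt_eq_sum_columns f col, card_lt_eq_sum_columns row col]
  exact Finset.sum_le_sum fun c _ => card_column_lt_le hdown hf c i

/-- Equality of the totals forces equality in every column, so on each column `f` only rearranges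
the row numbers. -/
theorem exists_perm_of_card_lt_eq
    (hdown : ∀ j, ∀ i < row j, ∃ j', row j' = i ∧ col j' = col j)
    (hf : Function.Injective fun j => (f j, col j))
    (hcard : ∀ i, (Finset.univ.filter fun j => f j < i).card =
      (Finset.univ.filter fun j => row j < i).card) :
    ∃ w : Equiv.Perm α, ∀ j, row (w j) = f j ∧ col (w j) = col j := by
  have key : ∀ j, ∃ j', row j' = f j ∧ col j' = col j := by
    intro j
    by_contra hcon
    push Not at hcon
    -- If row `f j` is missing from the column of `j`, the whole column lies above it. All of it is
    -- then counted for `row`, but `j` is not counted for `f`, against the columnwise equality.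
    have hlt : ∀ x, col x = col j → row x < f j := by
      intro x hx
      by_contra hle
      rcases (not_lt.1 hle).lt_or_eq with h | h
      · obtain ⟨y, hy, hy'⟩ := hdown x _ h
        exact hcon y hy (hy'.trans hx)
      · exact hcon x h.symm hx
    have hc := hcard (f j)
    rw [card_lt_eq_sum_columns f col, card_lt_eq_sum_columns row col,
      Finset.sum_eq_sum_iff_of_le fun c _ => card_column_lt_le hdown hf c (f j)] at hc
    have hj := hc (col j) (by simp)
    refine (Finset.card_lt_card (Finset.ssubset_iff_subset_ne.2 ⟨?_, ?_⟩)).ne hj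
    · intro x hx
      simp only [Finset.mem_filter, Finset.mem_univ, true_and] at hx ⊢
      exact ⟨hlt x hx.2, hx.2⟩
    · intro h
      have : j ∈ Finset.univ.filter fun x => row x < f j ∧ col x = col j := by
        simpa using hlt j rfl
      rw [← h] at this
      simp at this
  choose w hw using key
  have hinj : Function.Injective w := by
    intro x y hxy
    refine hf (Prod.ext ?_ ?_)
    · exact (hw x).1.symm.trans ((congrArg row hxy).trans (hw y).1)
    · exact (hw x).2.symm.trans ((congrArg col hxy).trans (hw y).2)
  exact ⟨Equiv.ofBijective w (Finite.injective_iff_bijective.1 hinj), hw⟩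

end Diagram

/-! ### Row-reading tableaux -/

section Tableau

variable {d : ℕ}

theorem row_lt_iff (c : Composition d) (j : Fin d) (i : ℕ) : row c j < i ↔ (j : ℕ) < c.sizeUpTo i := by
  constructor
  · intro h
    exact (c.lt_sizeUpTo_index_succ j).trans_le (c.monotone_sizeUpTo h)
  · intro h
    by_contra hle
    exact (h.trans_le (c.monotone_sizeUpTo (not_lt.1 hle))).not_ge (c.sizeUpTo_index_le j)

theorem card_row_lt (c : Composition d) (i : ℕ) :
    (Finset.univ.filter fun j => row c j < i).card = c.sizeUpTo i := by
  simp only [row_lt_iff]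
  rw [Fin.card_filter_val_lt]
  exact min_eq_right (c.sizeUpTo_le i)

theorem row_col_injective (c : Composition d) :
    Function.Injective fun j => (row c j, col c j) := by
  intro x y h
  have h1 : row c x = row c y := congrArg Prod.fst h
  have h2 : col c x = col c y := congrArg Prod.snd h
  have hx := c.sizeUpTo_index_le x
  have hy := c.sizeUpTo_index_le y
  simp only [col, Composition.coe_invEmbedding] at h2
  simp only [row] at h1
  rw [h1] at h2 hx
  exact Fin.ext (by omega)

theorem exists_row_col (p : Nat.Partition d) (j : Fin d) (i : ℕ)
    (hi : i < row (toComposition p) j) :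
    ∃ j', row (toComposition p) j' = i ∧ col (toComposition p) j' = col (toComposition p) j := by
  set c := toComposition p
  have hi' : i < c.length := hi.trans (c.index j).2
  have hblocks : c.blocksFun (c.index j) ≤ c.blocksFun ⟨i, hi'⟩ := by
    have hs : c.blocks.Pairwise (· ≥ ·) := Multiset.pairwise_sort _ _
    exact List.pairwise_iff_get.1 hs ⟨i, hi'⟩ (c.index j) hi
  refine ⟨c.embedding ⟨i, hi'⟩ ⟨col c j, (c.invEmbedding j).2.trans_le hblocks⟩, ?_, ?_⟩
  · simp [row, c.index_embedding]
  · exact c.invEmbedding_comp _ _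

theorem Dominates.trans {p q s : Nat.Partition d} (h : Dominates p q) (h' : Dominates q s) :
    Dominates p s := fun i => (h' i).trans (h i)

theorem Dominates.antisymm {p q : Nat.Partition d} (h : Dominates p q) (h' : Dominates q p) :
    p = q := by
  have hs : ∀ i, (toComposition p).sizeUpTo i = (toComposition q).sizeUpTo i :=
    fun i => le_antisymm (h' i) (h i)
  -- Partial sums grow strictly up to the length and are constant afterwards, so they determine the
  -- length.
  have hlen : ∀ a b : Composition d, (∀ i, a.sizeUpTo i = b.sizeUpTo i) → a.length ≤ b.length := by
    intro a b hab
    by_contra hlt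
    have h1 := a.sizeUpTo_strict_mono (not_le.1 hlt)
    rw [hab, hab, b.sizeUpTo_length, b.sizeUpTo_ofLength_le _ (Nat.le_succ _)] at h1
    exact lt_irrefl _ h1
  have hl := le_antisymm (hlen _ _ hs) (hlen _ _ fun i => (hs i).symm)
  have hb : (toComposition p).blocks = (toComposition q).blocks := by
    refine List.ext_getElem hl fun i h1 h2 => ?_
    have e1 := (toComposition p).sizeUpTo_succ (i := i) h1
    have e2 := (toComposition q).sizeUpTo_succ (i := i) h2
    rw [hs, hs] at e1
    omega
  apply Nat.Partition.ext
  have := congrArg (fun l : List ℕ => (l : Multiset ℕ)) hb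
  simpa [toComposition, Multiset.sort_eq] using this

/-- If no two entries of a row of the `q`-tabloid of `g` lie in the same column of the row-reading
tableau of shape `p`, then `p` dominates `q`. -/
theorem dominates_of_injective {p q : Nat.Partition d} (g : Equiv.Perm (Fin d))
    (h : Function.Injective fun j =>
      (row (toComposition q) (g⁻¹ j), col (toComposition p) j)) : Dominates p q := by
  intro i
  have := card_lt_le (exists_row_col p) h i
  rw [card_row_lt] at this
  refine le_trans (le_of_eq ?_) this
  rw [← card_row_lt]
  exact Finset.card_bij' (fun j _ => g j) (fun j _ => g⁻¹ j) (by simp) (by simp) (by simp) (by simp)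

/-- With equal shapes the row counts agree, so a column permutation carries each entry to its row in
the tabloid of `g`; what remains is a row permutation. -/
theorem exists_column_mul_row {p : Nat.Partition d} (g : Equiv.Perm (Fin d))
    (h : Function.Injective fun j =>
      (row (toComposition p) (g⁻¹ j), col (toComposition p) j)) :
    ∃ v ∈ columnSubgroup (toComposition p), ∃ w ∈ youngSubgroup (toComposition p), g = v * w := by
  obtain ⟨w, hw⟩ := exists_perm_of_card_lt_eq (exists_row_col p) h (fun i => by
    exact Finset.card_bij' (fun j _ => g⁻¹ j) (fun j _ => g j) (by simp) (by simp) (by simp)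
      (by simp))
  refine ⟨w⁻¹, inv_mem (fun j => (hw j).2), w * g, fun j => ?_, by simp⟩
  simpa using (hw (g j)).1

end Tableau

/-! ### Endomorphisms afforded by a quasi-idempotent of rank one -/

section RankOne

variable {k A S : Type*} [Field k] [Ring A] [Algebra k A] [AddCommGroup S] [Module k S]
  [Module A S] [IsScalarTower k A S]

variable (k) in
/-- The two-sided ideal generated by `κ`, as a subspace. -/
def idealSpan (κ : A) : Submodule k A :=
  Submodule.span k (Set.range fun p : A × A => p.1 * κ * p.2)

theorem smul_eq_zero_of_mem_idealSpan {κ : A} (h : ∀ s : S, κ • s = 0) {y : A}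
    (hy : y ∈ idealSpan k κ) (s : S) : y • s = 0 := by
  induction hy using Submodule.span_induction generalizing s with
  | mem x hx =>
    obtain ⟨p, rfl⟩ := hx
    simp [mul_smul, h]
  | zero => simp
  | add x y _ _ hx hy => rw [add_smul, hx, hy, add_zero]
  | smul c x _ hx => rw [smul_assoc, hx, smul_zero]

/-- Writing `κ • s = φ(s) e`, the element `a κ b` acts as `s ↦ φ(b s) a e`. The vectors `a e` fill
`S`, and by `hker` the functionals `φ ∘ b` span the dual, so all rank-one operators occur, hence all
operators. -/
theorem exists_mem_idealSpan_smul_eq [Module.Finite k S] {κ : A} {e : S} (he : e ≠ 0)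
    (hspan : ∀ s : S, ∃ a : A, a • e = s) (hκ : ∀ s : S, ∃ c : k, κ • s = c • e)
    (hker : ∀ s : S, (∀ b : A, κ • b • s = 0) → s = 0) (g : Module.End k S) :
    ∃ y ∈ idealSpan k κ, ∀ s : S, y • s = g s := by
  choose φ hφ using hκ
  have hinj : ∀ c c' : k, c • e = c' • e → c = c' := fun c c' h => smul_left_injective k he h
  let φl : S →ₗ[k] k :=
    { toFun := φ
      map_add' := fun s t => hinj _ _ (by rw [add_smul, ← hφ, ← hφ, ← hφ, smul_add])
      map_smul' := fun c s => hinj _ _ (by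
        rw [RingHom.id_apply, smul_eq_mul, mul_smul, ← hφ, ← hφ, smul_algebra_smul_comm]) }
  let W : Submodule k (Module.Dual k S) :=
    Submodule.span k (Set.range fun b : A => φl ∘ₗ Algebra.lsmul k k S b)
  have hW : W = ⊤ := by
    suffices h : W.dualCoannihilator = ⊥ by
      rw [← Subspace.dualCoannihilator_dualAnnihilator_eq (W := W), h,
        Submodule.dualAnnihilator_bot]
    rw [eq_bot_iff]
    intro s hs
    refine hker s fun b => ?_
    rw [hφ]
    have : φl (b • s) = 0 :=
      (Submodule.mem_dualCoannihilator s).1 hs _ (Submodule.subset_span ⟨b, rfl⟩)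
    change φl (b • s) • e = 0
    rw [this, zero_smul]
  have hrank : ∀ ψ : Module.Dual k S, ∀ s : S, ∃ y ∈ idealSpan k κ, ∀ t : S, y • t = ψ t • s := by
    intro ψ s
    obtain ⟨a, rfl⟩ := hspan s
    have hψ : ψ ∈ W := by rw [hW]; trivial
    induction hψ using Submodule.span_induction with
    | mem x hx =>
      obtain ⟨b, rfl⟩ := hx
      refine ⟨a * κ * b, Submodule.subset_span ⟨(a, b), rfl⟩, fun t => ?_⟩
      rw [mul_smul, mul_smul, hφ, smul_algebra_smul_comm]
      rfl
    | zero => exact ⟨0, zero_mem _, by simp⟩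
    | add x y _ _ hx hy =>
      obtain ⟨u, hu, hu'⟩ := hx
      obtain ⟨v, hv, hv'⟩ := hy
      exact ⟨u + v, add_mem hu hv, fun t => by rw [add_smul, hu', hv', ← add_smul]; rfl⟩
    | smul c x _ hx =>
      obtain ⟨u, hu, hu'⟩ := hx
      exact ⟨c • u, Submodule.smul_mem _ _ hu, fun t => by
        rw [smul_assoc, hu', smul_smul]; rfl⟩
  let B := Module.finBasis k S
  choose y hy hy' using fun i => hrank (B.coord i) (g (B i))
  refine ⟨∑ i, y i, sum_mem fun i _ => hy i, fun s => ?_⟩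
  rw [Finset.sum_smul]
  simp only [hy']
  conv_rhs => rw [← B.sum_repr s, map_sum]
  simp

end RankOne

/-! ### Nondegeneracy of the functional, by Maschke's theorem -/

section Maschke

variable {k G V : Type*} [Field k] [Group G] [Finite G] [CharZero k] [AddCommGroup V]
  [Module k V] [Module (MonoidAlgebra k G) V] [IsScalarTower k (MonoidAlgebra k G) V]

/-- The vectors `s` in question form a submodule `N`, which has an equivariant projection `π`. Then
`c π(e) = π(κ e) = κ π(e) = 0`, so `π` kills the generator `e` and `N = 0`. -/
theorem eq_zero_of_forall_smul_smul_eq_zero {κ : MonoidAlgebra k G} {e : V} {c : k} (hc : c ≠ 0)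
    (hspan : ∀ s : V, ∃ a : MonoidAlgebra k G, a • e = s) (hκ : κ • e = c • e) (s : V)
    (hs : ∀ b : MonoidAlgebra k G, κ • b • s = 0) : s = 0 := by
  let N : Submodule (MonoidAlgebra k G) V :=
    { carrier := {s | ∀ b : MonoidAlgebra k G, κ • b • s = 0}
      add_mem' := fun hx hy b => by rw [smul_add, smul_add, hx, hy, add_zero]
      zero_mem' := fun b => by simp
      smul_mem' := fun a x hx b => by rw [smul_smul b]; exact hx _ }
  have : NeZero (Nat.card G : k) := ⟨by exact_mod_cast Nat.card_pos.ne'⟩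
  obtain ⟨π, hπ⟩ := MonoidAlgebra.exists_leftInverse_of_injective N.subtype N.ker_subtype
  have h0 : κ • π e = 0 := by
    have := (π e).2 1
    rw [one_smul] at this
    exact Subtype.ext this
  rw [← map_smul, hκ, ← algebraMap_smul (MonoidAlgebra k G) c e, map_smul] at h0
  have h1 : π e = 0 := by
    have := congrArg (fun x => algebraMap k (MonoidAlgebra k G) c⁻¹ • x) h0
    simpa only [smul_smul, ← map_mul, inv_mul_cancel₀ hc, map_one, one_smul, smul_zero] using this
  obtain ⟨a, ha⟩ := hspan s
  have h2 : π s = 0 := by rw [← ha, map_smul, h1, smul_zero]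
  have h3 := LinearMap.congr_fun hπ ⟨s, hs⟩
  simp only [LinearMap.comp_apply, Submodule.subtype_apply, LinearMap.id_apply, h2] at h3
  exact congrArg Subtype.val h3.symm

end Maschke

/-! ### Families of modules -/

section Family

variable {k A I : Type*} {S : I → Type*} [Field k] [Ring A] [Algebra k A]
  [∀ i, AddCommGroup (S i)] [∀ i, Module k (S i)] [∀ i, Module A (S i)]
  [∀ i, IsScalarTower k A (S i)]

/-- An element of the ideal of `κ i` acts only on `S i` and on the modules strictly below it. Its
action on the latter is removed by induction along the order. -/
theorem exists_smul_eq_single [Finite I] {κ : I → A} {r : I → I → Prop}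
    (htrans : ∀ i j l, r i j → r j l → r i l) (hanti : ∀ i j, r i j → r j i → i = j)
    (htri : ∀ i j, ¬ r i j → ∀ s : S j, κ i • s = 0)
    (hsurj : ∀ i, ∀ g : Module.End k (S i), ∃ y ∈ idealSpan k (κ i), ∀ s : S i, y • s = g s) :
    ∀ i, ∀ g : Module.End k (S i),
      ∃ x : A, (∀ s : S i, x • s = g s) ∧ ∀ j, j ≠ i → ∀ s : S j, x • s = 0 := by
  classical
  have := Fintype.ofFinite I
  let lt : I → I → Prop := fun j i => r i j ∧ j ≠ i
  have : IsTrans I lt := ⟨fun a b c hab hbc => ⟨htrans _ _ _ hbc.1 hab.1, by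
    rintro rfl
    exact hab.2 (hanti _ _ hbc.1 hab.1)⟩⟩
  have : Std.Irrefl lt := ⟨fun a h => h.2 rfl⟩
  have hwf : WellFounded lt := Finite.wellFounded_of_trans_of_irrefl lt
  intro i
  induction i using hwf.induction with
  | _ i ih =>
    intro g
    obtain ⟨y, hy, hyg⟩ := hsurj i g
    have hz : ∀ j, ∃ z : A, lt j i → (∀ s : S j, z • s = y • s) ∧
        ∀ l, l ≠ j → ∀ s : S l, z • s = 0 := by
      intro j
      by_cases hj : lt j i
      · obtain ⟨z, h1, h2⟩ := ih j hj (Algebra.lsmul k k (S j) y)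
        exact ⟨z, fun _ => ⟨h1, h2⟩⟩
      · exact ⟨0, fun h => absurd h hj⟩
    choose z hz using hz
    refine ⟨y - ∑ j with lt j i, z j, fun s => ?_, fun l hl s => ?_⟩
    · rw [sub_smul, hyg, Finset.sum_smul, Finset.sum_eq_zero, sub_zero]
      intro j hj
      have hj' := (Finset.mem_filter.1 hj).2
      exact (hz j hj').2 i hj'.2.symm s
    · rw [sub_smul, Finset.sum_smul]
      by_cases hli : lt l i
      · rw [Finset.sum_eq_single_of_mem l (by simpa using hli), (hz l hli).1, sub_self]
        intro j hj hjl
        exact (hz j (Finset.mem_filter.1 hj).2).2 l hjl.symm s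
      · rw [smul_eq_zero_of_mem_idealSpan (htri i l fun h => hli ⟨h, hl⟩) hy, Finset.sum_eq_zero,
          sub_zero]
        intro j hj
        have hj' := (Finset.mem_filter.1 hj).2
        refine (hz j hj').2 l ?_ s
        rintro rfl
        exact hli hj'

end Family

/-! ### Completeness of a family by counting conjugacy classes -/

section Center

variable {k G I : Type*} {S : I → Type*} [Field k] [Group G] [Fintype G]
  [∀ i, AddCommGroup (S i)] [∀ i, Module k (S i)] [∀ i, Module (MonoidAlgebra k G) (S i)]
  [∀ i, IsScalarTower k (MonoidAlgebra k G) (S i)]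

open MonoidAlgebra in
/-- The sum of all conjugates of an element of the group algebra. -/
noncomputable def conjSum (x : MonoidAlgebra k G) : MonoidAlgebra k G :=
  ∑ h : G, single h 1 * x * single h⁻¹ 1

open MonoidAlgebra in
theorem single_mul_conjSum (x : MonoidAlgebra k G) (g : G) :
    single g 1 * conjSum x = conjSum x * single g 1 := by
  unfold conjSum
  rw [Finset.mul_sum, Finset.sum_mul]
  refine Fintype.sum_equiv (Equiv.mulLeft g) _ _ fun h => ?_
  simp only [Equiv.coe_mulLeft, mul_assoc, single_mul_single, mul_inv_rev, one_mul]
  rw [← mul_assoc (single g 1), single_mul_single]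
  simp

open MonoidAlgebra in
theorem conjSum_mem_center (x : MonoidAlgebra k G) :
    conjSum x ∈ Subalgebra.center k (MonoidAlgebra k G) := by
  rw [Subalgebra.mem_center_iff]
  intro b
  induction b using MonoidAlgebra.induction_linear with
  | zero => simp
  | add f g hf hg => rw [add_mul, mul_add, hf, hg]
  | single g c =>
    have : single g c = c • single g (1 : k) := by simp
    rw [this, smul_mul_assoc, single_mul_conjSum, mul_smul_comm]

open MonoidAlgebra in
theorem coeff_conjSum_one (x : MonoidAlgebra k G) :
    (conjSum x).coeff 1 = Fintype.card G * x.coeff 1 := by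
  unfold conjSum
  rw [coeff_sum, Finsupp.finsetSum_apply]
  simp [coeff_mul_single_apply, coeff_single_mul_apply]

theorem conjSum_smul {V : Type*} [AddCommGroup V] [Module k V] [Module (MonoidAlgebra k G) V]
    [IsScalarTower k (MonoidAlgebra k G) V] {x : MonoidAlgebra k G} {c : k}
    (h : ∀ s : V, x • s = c • s) (s : V) : conjSum x • s = (Fintype.card G * c) • s := by
  unfold conjSum
  rw [Finset.sum_smul]
  have : ∀ g : G, (MonoidAlgebra.single g 1 * x * MonoidAlgebra.single g⁻¹ (1 : k)) • s = c • s := by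
    intro g
    rw [mul_smul, mul_smul, h, smul_algebra_smul_comm, smul_smul, MonoidAlgebra.single_mul_single,
      mul_inv_cancel, mul_one, ← MonoidAlgebra.one_def, one_smul]
  simp only [this, Finset.sum_const, Finset.card_univ, mul_smul]
  rw [Nat.cast_smul_eq_nsmul]

theorem coeff_eq_of_mem_center {k G : Type*} [Field k] [Group G] {z : MonoidAlgebra k G}
    (hz : z ∈ Subalgebra.center k (MonoidAlgebra k G)) {g h : G} (hgh : IsConj g h) :
    z.coeff g = z.coeff h := by
  obtain ⟨x, rfl⟩ := isConj_iff.1 hgh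
  have := congrArg (fun y => y.coeff (x * g))
    (Subalgebra.mem_center_iff.1 hz (MonoidAlgebra.single x 1))
  simpa [MonoidAlgebra.coeff_mul_single_apply, MonoidAlgebra.coeff_single_mul_apply] using this

theorem finrank_center_le {J : Type*} [Fintype J] (cls : G → J)
    (hcls : ∀ g h, cls g = cls h → IsConj g h) :
    Module.finrank k (Subalgebra.center k (MonoidAlgebra k G)) ≤ Fintype.card J := by
  classical
  let T : Subalgebra.center k (MonoidAlgebra k G) →ₗ[k] (J → k) :=
    -- One coefficient is read off per conjugacy class; labels in `J` not attained by `cls` get the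
    -- value `0`.
    { toFun := fun z j => if h : ∃ g, cls g = j then z.1.coeff h.choose else 0
      map_add' := fun y z => by
        ext j
        by_cases h : ∃ g, cls g = j <;> simp [h]
      map_smul' := fun c z => by
        ext j
        by_cases h : ∃ g, cls g = j <;> simp [h] }
  have hT : Function.Injective T := by
    rw [injective_iff_map_eq_zero]
    intro z hz
    apply Subtype.ext
    ext g
    have h : ∃ g', cls g' = cls g := ⟨g, rfl⟩
    have h1 := congrFun hz (cls g)
    simp only [T, LinearMap.coe_mk, AddHom.coe_mk, dif_pos h, Pi.zero_apply] at h1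
    rw [coeff_eq_of_mem_center z.2 (hcls _ _ h.choose_spec)] at h1
    simpa using h1
  simpa using LinearMap.finrank_le_finrank_of_injective hT

/-- Averaging the elements that isolate each `S i` gives `card I` independent central elements. A
nonzero central element killing the family would be independent of them, exceeding the dimension of
the centre. A general `x` reduces to central elements by averaging its translates. -/
theorem eq_zero_of_forall_smul_eq_zero [CharZero k] [Fintype I] [∀ i, Nontrivial (S i)]
    {J : Type*} [Fintype J] (cls : G → J) (hcls : ∀ g h, cls g = cls h → IsConj g h)
    (hJ : Fintype.card J ≤ Fintype.card I)
    (hsingle : ∀ i, ∀ g : Module.End k (S i), ∃ x : MonoidAlgebra k G,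
      (∀ s : S i, x • s = g s) ∧ ∀ j, j ≠ i → ∀ s : S j, x • s = 0)
    {x : MonoidAlgebra k G} (hx : ∀ i, ∀ s : S i, x • s = 0) : x = 0 := by
  classical
  set Z := Subalgebra.center k (MonoidAlgebra k G)
  have hcard : (Fintype.card G : k) ≠ 0 := by exact_mod_cast Fintype.card_ne_zero
  choose u hu hu' using fun i => hsingle i 1
  let z : I → Z := fun i => ⟨conjSum (u i), conjSum_mem_center _⟩
  have hz : ∀ i, ∀ s : S i, (z i).1 • s = (Fintype.card G : k) • s := by
    intro i s
    rw [show (z i).1 = conjSum (u i) from rfl, conjSum_smul (c := 1) (by simpa using hu i), mul_one]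
  have hz' : ∀ i j, j ≠ i → ∀ s : S j, (z i).1 • s = 0 := by
    intro i j hij s
    rw [show (z i).1 = conjSum (u i) from rfl, conjSum_smul (c := 0) (by simpa using hu' i j hij),
      mul_zero, zero_smul]
  -- a central element that kills every `S i` is independent of the elements `z i`
  have hker : ∀ y : Z, (∀ i, ∀ s : S i, y.1 • s = 0) → y = 0 := by
    intro y hy
    by_contra hne
    let v : Option I → Z := fun o => o.elim y z
    have hv : LinearIndependent k v := by
      rw [Fintype.linearIndependent_iff]
      intro c hc
      rw [Fintype.sum_option] at hc
      have hsome : ∀ i, c (some i) = 0 := by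
        intro i
        obtain ⟨s, hs⟩ := exists_ne (0 : S i)
        have h1 := congrArg (fun w : Z => w.1 • s) hc
        simp only [v, Option.elim, Subalgebra.coe_add, Subalgebra.coe_smul, add_smul, smul_assoc,
          hy, AddSubmonoidClass.coe_finsetSum, Finset.sum_smul, ZeroMemClass.coe_zero, zero_smul,
          smul_zero, zero_add] at h1
        rw [Finset.sum_eq_single i (fun j _ hj => by rw [hz' j i hj.symm, smul_zero]) (by simp), hz,
          smul_smul] at h1
        exact (mul_eq_zero.1 ((smul_eq_zero.1 h1).resolve_right hs)).resolve_right hcard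
      intro o
      cases o with
      | some i => exact hsome i
      | none =>
        simp only [hsome, zero_smul, Finset.sum_const_zero, add_zero] at hc
        exact (smul_eq_zero.1 hc).resolve_right hne
    have h1 := hv.fintype_card_le_finrank
    have h2 := finrank_center_le (k := k) cls hcls
    rw [Fintype.card_option] at h1
    have h3 := h1.trans h2
    omega
  ext g
  -- Translation by `g⁻¹` moves the coefficient at `g` to the identity, where averaging only
  -- multiplies it by the group order.
  have h1 := hker ⟨conjSum (MonoidAlgebra.single g⁻¹ 1 * x), conjSum_mem_center _⟩ (by
    intro i s
    change conjSum _ • s = 0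
    rw [conjSum_smul (c := 0) (by intro s; rw [mul_smul, hx, smul_zero, zero_smul]), mul_zero,
      zero_smul])
  have h2 : (conjSum (MonoidAlgebra.single g⁻¹ 1 * x)).coeff 1 = 0 := by
    rw [show conjSum (MonoidAlgebra.single g⁻¹ 1 * x) = 0 from congrArg Subtype.val h1]; rfl
  rw [coeff_conjSum_one] at h2
  simpa [MonoidAlgebra.coeff_single_mul_apply, hcard] using h2

end Center

/-! ### Tabloids and polytabloids -/

section Tabloid

open MonoidAlgebra

variable {k : Type*} [Field k] {d : ℕ}

/-- The inverse appears because the group acts on the induced module through right multiplication by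
inverses. -/
theorem single_smul_tabloid (p : Nat.Partition d) (g : Equiv.Perm (Fin d)) (c : k) :
    single g c • tabloid k p = (permRep k (toComposition p)).asModuleEquiv.symm
      (Representation.IndV.mk (youngSubgroup (toComposition p)).subtype
        (Representation.trivial k (youngSubgroup (toComposition p)) k) g⁻¹ c) := by
  rw [Representation.single_smul, tabloid]
  change c • (permRep k (toComposition p)) g _ = _
  rw [LinearEquiv.apply_symm_apply, Representation.ind_mk, ← map_smul, one_mul, smul_eq_mul,
    mul_one]
  rfl

theorem single_smul_tabloid_of_mem {p : Nat.Partition d} {w : Equiv.Perm (Fin d)}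
    (hw : w ∈ youngSubgroup (toComposition p)) :
    single w (1 : k) • tabloid k p = tabloid k p := by
  rw [single_smul_tabloid, tabloid]
  congr 1
  have h := Representation.Coinvariants.mk_self_apply
    (Representation.tprod ((Representation.leftRegular k (Equiv.Perm (Fin d))).comp
      (youngSubgroup (toComposition p)).subtype)
      (Representation.trivial k (youngSubgroup (toComposition p)) k)) (⟨w, hw⟩⁻¹)
    (TensorProduct.tmul k (single 1 1) 1)
  refine Eq.trans ?_ h
  simp

theorem exists_smul_tabloid (p : Nat.Partition d) (m : PermModule k p) :
    ∃ a : MonoidAlgebra k (Equiv.Perm (Fin d)), a • tabloid k p = m := by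
  obtain ⟨m, rfl⟩ := (permRep k (toComposition p)).asModuleEquiv.symm.surjective m
  induction m using Representation.Coinvariants.induction_on with
  | _ t =>
    induction t using TensorProduct.induction_on with
    | zero => exact ⟨0, by simp⟩
    | add x y hx hy =>
      obtain ⟨a, ha⟩ := hx
      obtain ⟨b, hb⟩ := hy
      exact ⟨a + b, by rw [add_smul, ha, hb, map_add, map_add]⟩
    | tmul x c =>
      induction x using MonoidAlgebra.induction_linear with
      | zero => exact ⟨0, by simp⟩
      | add x y hx hy =>
        obtain ⟨a, ha⟩ := hx
        obtain ⟨b, hb⟩ := hy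
        exact ⟨a + b, by rw [add_smul, ha, hb, TensorProduct.add_tmul, map_add, map_add]⟩
      | single g b =>
        refine ⟨single g⁻¹ (b * c), ?_⟩
        rw [single_smul_tabloid, inv_inv]
        congr 1
        simp only [Representation.IndV.mk, LinearMap.comp_apply, TensorProduct.mk_apply]
        congr 1
        rw [show single g b = b • single g (1 : k) by simp, TensorProduct.smul_tmul, smul_eq_mul]

open Classical in
/-- The sum of the elements of the Young subgroup of shape `p`. -/
noncomputable def rowSymmetrizer (k : Type*) [Field k] {d : ℕ} (p : Nat.Partition d) :
    MonoidAlgebra k (Equiv.Perm (Fin d)) :=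
  ∑ w : Equiv.Perm (Fin d) with w ∈ youngSubgroup (toComposition p), single w 1

theorem single_mul_rowSymmetrizer {p : Nat.Partition d} {w : Equiv.Perm (Fin d)}
    (hw : w ∈ youngSubgroup (toComposition p)) :
    single w (1 : k) * rowSymmetrizer k p = rowSymmetrizer k p := by
  classical
  unfold rowSymmetrizer
  rw [Finset.mul_sum]
  refine Finset.sum_bij' (fun v _ => w * v) (fun v _ => w⁻¹ * v) ?_ ?_ ?_ ?_ ?_
  · intro v hv
    simpa [Subgroup.mul_mem_cancel_left _ hw] using hv
  · intro v hv
    simpa [Subgroup.mul_mem_cancel_left _ (inv_mem hw)] using hv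
  · simp
  · simp
  · simp [single_mul_single]

open Classical in
theorem coeff_mul_rowSymmetrizer (p : Nat.Partition d)
    (a : MonoidAlgebra k (Equiv.Perm (Fin d))) (g : Equiv.Perm (Fin d)) :
    (a * rowSymmetrizer k p).coeff g =
      ∑ w : Equiv.Perm (Fin d) with w ∈ youngSubgroup (toComposition p), a.coeff (g * w⁻¹) := by
  rw [rowSymmetrizer, Finset.mul_sum, coeff_sum, Finsupp.finsetSum_apply]
  simp [coeff_mul_single_apply]

theorem rowSymmetrizer_smul {W : Type*} [AddCommGroup W] [Module k W]
    [Module (MonoidAlgebra k (Equiv.Perm (Fin d))) W] {p : Nat.Partition d} {x : W}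
    (hx : ∀ w ∈ youngSubgroup (toComposition p), single w (1 : k) • x = x) :
    ∃ n : ℕ, n ≠ 0 ∧ rowSymmetrizer k p • x = (n : k) • x := by
  classical
  refine ⟨(Finset.univ.filter fun w => w ∈ youngSubgroup (toComposition p)).card,
    (Finset.card_pos.2 ⟨1, by simp [one_mem]⟩).ne', ?_⟩
  rw [rowSymmetrizer, Finset.sum_smul,
    Finset.sum_congr rfl fun w hw => hx w (Finset.mem_filter.1 hw).2, Finset.sum_const,
    ← Nat.cast_smul_eq_nsmul k]

/-- The linear map from the permutation module to the group algebra sending the tabloid to the row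
symmetrizer. -/
noncomputable def toGroupAlgebra (k : Type*) [Field k] {d : ℕ} (p : Nat.Partition d) :
    PermModule k p →ₗ[k] MonoidAlgebra k (Equiv.Perm (Fin d)) :=
  Representation.Coinvariants.lift _
    (LinearMap.mulRight k (rowSymmetrizer k p) ∘ₗ mapDomainLinearMap k k (fun g => g⁻¹) ∘ₗ
      (TensorProduct.rid k (MonoidAlgebra k (Equiv.Perm (Fin d)))).toLinearMap) (by
    intro w
    ext g : 4
    simp only [Representation.tprod_apply, LinearMap.comp_apply,
      TensorProduct.AlgebraTensorModule.curry_apply, TensorProduct.curry_apply,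
      LinearMap.restrictScalars_apply, TensorProduct.map_tmul, lsingle_apply]
    simp
    rw [show single (g⁻¹ * (w : Equiv.Perm (Fin d))⁻¹) (1 : k) = single g⁻¹ 1 * single (w : Equiv.Perm (Fin d))⁻¹ 1 by
      simp [single_mul_single], mul_assoc, single_mul_rowSymmetrizer (inv_mem w.2)]) ∘ₗ
  (permRep k (toComposition p)).asModuleEquiv.toLinearMap

theorem toGroupAlgebra_smul_tabloid (p : Nat.Partition d)
    (a : MonoidAlgebra k (Equiv.Perm (Fin d))) :
    toGroupAlgebra k p (a • tabloid k p) = a * rowSymmetrizer k p := by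
  induction a using MonoidAlgebra.induction_linear with
  | zero => simp
  | add x y hx hy => rw [add_smul, map_add, hx, hy, add_mul]
  | single g c =>
    rw [single_smul_tabloid]
    simp [toGroupAlgebra]

/-- The tabloid is, up to a nonzero integer, its own image under the row symmetrizer, so equations
in `M^p` become equations in the group algebra. -/
theorem smul_tabloid_eq_zero_iff [CharZero k] (p : Nat.Partition d)
    (a : MonoidAlgebra k (Equiv.Perm (Fin d))) :
    a • tabloid k p = 0 ↔ a * rowSymmetrizer k p = 0 := by
  constructor
  · intro h
    rw [← toGroupAlgebra_smul_tabloid, h, map_zero]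
  · intro h
    obtain ⟨n, hn, h1⟩ := rowSymmetrizer_smul (k := k) fun w hw =>
      single_smul_tabloid_of_mem (p := p) hw
    have h2 : (n : k) • (a • tabloid k p) = 0 := by
      rw [← smul_algebra_smul_comm, ← h1, smul_smul, h, zero_smul]
    exact (smul_eq_zero.1 h2).resolve_left (by exact_mod_cast hn)

theorem mem_annihilator_iff (p : Nat.Partition d) {x : MonoidAlgebra k (Equiv.Perm (Fin d))} :
    x ∈ Module.annihilator (MonoidAlgebra k (Equiv.Perm (Fin d))) (PermModule k p) ↔
      ∀ a, (x * a) • tabloid k p = 0 := by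
  rw [Module.mem_annihilator]
  constructor
  · intro h a
    rw [mul_smul, h]
  · intro h m
    obtain ⟨a, rfl⟩ := exists_smul_tabloid p m
    rw [smul_smul, h]

/-- An element annihilating `M^p` annihilates every module generated by a vector that is fixed by
the Young subgroup of shape `p`. -/
theorem mul_smul_eq_zero_of_mem_annihilator [CharZero k] {W : Type*} [AddCommGroup W] [Module k W]
    [Module (MonoidAlgebra k (Equiv.Perm (Fin d))) W]
    [IsScalarTower k (MonoidAlgebra k (Equiv.Perm (Fin d))) W] {p : Nat.Partition d}
    {x : MonoidAlgebra k (Equiv.Perm (Fin d))}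
    (hx : x ∈ Module.annihilator (MonoidAlgebra k (Equiv.Perm (Fin d))) (PermModule k p)) {v : W}
    (hv : ∀ w ∈ youngSubgroup (toComposition p), single w (1 : k) • v = v)
    (a : MonoidAlgebra k (Equiv.Perm (Fin d))) : (x * a) • v = 0 := by
  have h := (smul_tabloid_eq_zero_iff p _).1 ((mem_annihilator_iff p).1 hx a)
  obtain ⟨n, hn, h1⟩ := rowSymmetrizer_smul (k := k) hv
  have h2 : (n : k) • ((x * a) • v) = 0 := by
    rw [← smul_algebra_smul_comm, ← h1, smul_smul, h, zero_smul]
  exact (smul_eq_zero.1 h2).resolve_left (by exact_mod_cast hn)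

theorem columnAntisymmetrizer_mul_single {p : Nat.Partition d} {w : Equiv.Perm (Fin d)}
    (hw : w ∈ columnSubgroup (toComposition p)) :
    columnAntisymmetrizer k p * single w 1 =
      ((Equiv.Perm.sign w : ℤ) : k) • columnAntisymmetrizer k p := by
  classical
  unfold columnAntisymmetrizer
  rw [Finset.sum_mul, Finset.smul_sum]
  refine Finset.sum_bij' (fun v _ => v * w) (fun v _ => v * w⁻¹) ?_ ?_ ?_ ?_ ?_
  · intro v hv
    simpa [Subgroup.mul_mem_cancel_right _ hw] using hv
  · intro v hv
    simpa [Subgroup.mul_mem_cancel_right _ (inv_mem hw)] using hv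
  · simp
  · simp
  · intro v _
    rw [single_mul_single, smul_single, mul_one, smul_eq_mul]
    congr 1
    rw [map_mul, ← Int.cast_mul, ← Units.val_mul, mul_left_comm, Int.units_mul_self, mul_one]

theorem columnAntisymmetrizer_mul_self (p : Nat.Partition d) :
    ∃ n : ℕ, n ≠ 0 ∧ columnAntisymmetrizer k p * columnAntisymmetrizer k p =
      (n : k) • columnAntisymmetrizer k p := by
  classical
  refine ⟨(Finset.univ.filter fun w => w ∈ columnSubgroup (toComposition p)).card,
    (Finset.card_pos.2 ⟨1, by simp [one_mem]⟩).ne', ?_⟩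
  conv_lhs => rw [columnAntisymmetrizer, Finset.mul_sum]
  rw [Finset.sum_congr rfl, Finset.sum_const, ← Nat.cast_smul_eq_nsmul k]
  intro w hw
  change columnAntisymmetrizer k p * _ = _
  rw [show single w ((Equiv.Perm.sign w : ℤ) : k) = ((Equiv.Perm.sign w : ℤ) : k) • single w 1 by
    simp, mul_smul_comm, columnAntisymmetrizer_mul_single (Finset.mem_filter.1 hw).2, smul_smul,
    ← Int.cast_mul, ← Units.val_mul, Int.units_mul_self, Units.val_one, Int.cast_one, one_smul]

/-- Row and column stabilizers meet trivially, so the identity has coefficient `1` in the product of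
the two symmetrizers. -/
theorem columnAntisymmetrizer_smul_tabloid_ne_zero [CharZero k] (p : Nat.Partition d) :
    columnAntisymmetrizer k p • tabloid k p ≠ 0 := by
  classical
  rw [Ne, smul_tabloid_eq_zero_iff]
  intro h
  have h1 := congrArg (fun a => a.coeff 1) h
  simp only [coeff_mul_rowSymmetrizer, one_mul] at h1
  rw [Finset.sum_eq_single_of_mem 1 (by simp [one_mem])] at h1
  · rw [columnAntisymmetrizer, coeff_sum, Finsupp.finsetSum_apply,
      Finset.sum_eq_single_of_mem 1 (by simp [one_mem])] at h1
    · simp at h1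
    · intro w _ hw
      simp [hw]
  · intro w hw hw1
    rw [columnAntisymmetrizer, coeff_sum, Finsupp.finsetSum_apply]
    refine Finset.sum_eq_zero fun v hv => ?_
    rw [coeff_single, Finsupp.single_apply, if_neg]
    rintro rfl
    refine hw1 (Equiv.ext fun j => row_col_injective (toComposition p) (Prod.ext ?_ ?_))
    · exact (Finset.mem_filter.1 hw).2 j
    · have := (Finset.mem_filter.1 hv).2
      rw [inv_mem_iff] at this
      exact this j

/-- The column antisymmetrizer kills a tabloid with two entries in a row that lie in one column. -/
theorem columnAntisymmetrizer_smul_eq_zero [CharZero k] {p q : Nat.Partition d}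
    {g : Equiv.Perm (Fin d)}
    (h : ¬ Function.Injective fun j =>
      (row (toComposition q) (g⁻¹ j), col (toComposition p) j)) :
    columnAntisymmetrizer k p • single g (1 : k) • tabloid k q = 0 := by
  classical
  rw [Function.Injective] at h
  push Not at h
  obtain ⟨i, j, hij, hne⟩ := h
  have hr := congrArg Prod.fst hij
  have hc := congrArg Prod.snd hij
  simp only at hr hc
  -- The swap of the two entries fixes the tabloid but changes the sign of the antisymmetrizer, so
  -- the product equals its own negative.
  have hcol : Equiv.swap i j ∈ columnSubgroup (toComposition p) := by
    intro l
    by_cases hli : l = i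
    · subst hli; rw [Equiv.swap_apply_left, hc]
    · by_cases hlj : l = j
      · subst hlj; rw [Equiv.swap_apply_right, hc]
      · rw [Equiv.swap_apply_of_ne_of_ne hli hlj]
  have hrow : g⁻¹ * Equiv.swap i j * g ∈ youngSubgroup (toComposition q) := by
    intro l
    by_cases hli : g l = i
    · subst hli; simpa using hr.symm
    · by_cases hlj : g l = j
      · subst hlj; simpa using hr
      · simp [Equiv.swap_apply_of_ne_of_ne hli hlj]
  have h1 : single (Equiv.swap i j) (1 : k) • single g (1 : k) • tabloid k q =
      single g (1 : k) • tabloid k q := by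
    conv_rhs => rw [← single_smul_tabloid_of_mem hrow]
    rw [smul_smul, smul_smul, single_mul_single, single_mul_single, mul_one, mul_assoc g⁻¹,
      mul_inv_cancel_left]
  have h2 : columnAntisymmetrizer k p • single g (1 : k) • tabloid k q =
      -(columnAntisymmetrizer k p • single g (1 : k) • tabloid k q) := by
    conv_lhs => rw [← h1]
    rw [smul_smul, columnAntisymmetrizer_mul_single hcol, Equiv.Perm.sign_swap hne, Units.val_neg,
      Units.val_one, Int.cast_neg, Int.cast_one, neg_smul, one_smul, neg_smul]
  have h3 : (2 : k) • (columnAntisymmetrizer k p • single g (1 : k) • tabloid k q) = 0 := by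
    rw [two_smul]
    nth_rewrite 1 [h2]
    exact neg_add_cancel _
  exact (smul_eq_zero.1 h3).resolve_left two_ne_zero

theorem columnAntisymmetrizer_smul_of_not_dominates [CharZero k] {p q : Nat.Partition d}
    (h : ¬ Dominates p q) (m : PermModule k q) : columnAntisymmetrizer k p • m = 0 := by
  obtain ⟨a, rfl⟩ := exists_smul_tabloid q m
  induction a using MonoidAlgebra.induction_linear with
  | zero => simp
  | add x y hx hy => rw [add_smul, smul_add, hx, hy, add_zero]
  | single g c =>
    rw [show single g c = c • single g (1 : k) by simp, smul_assoc, smul_algebra_smul_comm,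
      columnAntisymmetrizer_smul_eq_zero fun hg => h (dominates_of_injective g hg), smul_zero]

theorem exists_columnAntisymmetrizer_smul_eq [CharZero k] {p : Nat.Partition d}
    (m : PermModule k p) :
    ∃ c : k, columnAntisymmetrizer k p • m = c • columnAntisymmetrizer k p • tabloid k p := by
  obtain ⟨a, rfl⟩ := exists_smul_tabloid p m
  induction a using MonoidAlgebra.induction_linear with
  | zero => exact ⟨0, by simp⟩
  | add x y hx hy =>
    obtain ⟨b, hb⟩ := hx
    obtain ⟨c, hc⟩ := hy
    exact ⟨b + c, by rw [add_smul, smul_add, hb, hc, add_smul]⟩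
  | single g c =>
    rw [show single g c = c • single g (1 : k) by simp, smul_assoc, smul_algebra_smul_comm]
    by_cases hg : Function.Injective fun j =>
        (row (toComposition p) (g⁻¹ j), col (toComposition p) j)
    · obtain ⟨v, hv, w, hw, rfl⟩ := exists_column_mul_row g hg
      refine ⟨c * ((Equiv.Perm.sign v : ℤ) : k), ?_⟩
      rw [show single (v * w) (1 : k) = single v 1 * single w 1 by simp [single_mul_single],
        mul_smul, single_smul_tabloid_of_mem hw, smul_smul, columnAntisymmetrizer_mul_single hv,
        smul_assoc, smul_smul]
    · exact ⟨0, by rw [columnAntisymmetrizer_smul_eq_zero hg, smul_zero, zero_smul]⟩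

end Tabloid

/-! ### Specht modules -/

section Specht

open MonoidAlgebra

variable {k : Type*} [Field k] {d : ℕ}

/-- The polytabloid of the row-reading tableau. -/
noncomputable def polytabloid (k : Type*) [Field k] {d : ℕ} (p : Nat.Partition d) : Specht k p :=
  ⟨columnAntisymmetrizer k p • tabloid k p, Submodule.mem_span_singleton_self _⟩

theorem polytabloid_ne_zero [CharZero k] (p : Nat.Partition d) : polytabloid k p ≠ 0 :=
  fun h => columnAntisymmetrizer_smul_tabloid_ne_zero p (congrArg Subtype.val h)

theorem exists_smul_polytabloid (p : Nat.Partition d) (s : Specht k p) :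
    ∃ a : MonoidAlgebra k (Equiv.Perm (Fin d)), a • polytabloid k p = s := by
  obtain ⟨a, ha⟩ := Submodule.mem_span_singleton.1 s.2
  exact ⟨a, Subtype.ext ha⟩

instance finite_specht (p : Nat.Partition d) : Module.Finite k (Specht k p) :=
  Module.Finite.of_surjective
    ((LinearMap.toSpanSingleton (MonoidAlgebra k (Equiv.Perm (Fin d))) _
      (polytabloid k p)).restrictScalars k) (exists_smul_polytabloid p)

theorem nontrivial_specht [CharZero k] (p : Nat.Partition d) : Nontrivial (Specht k p) :=
  ⟨polytabloid k p, 0, polytabloid_ne_zero p⟩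

theorem exists_mem_idealSpan_specht [CharZero k] (p : Nat.Partition d)
    (g : Module.End k (Specht k p)) :
    ∃ y ∈ idealSpan k (columnAntisymmetrizer k p), ∀ s : Specht k p, y • s = g s := by
  obtain ⟨n, hn, h⟩ := columnAntisymmetrizer_mul_self (k := k) p
  refine exists_mem_idealSpan_smul_eq (polytabloid_ne_zero p) (exists_smul_polytabloid p)
    (fun s => ?_) (eq_zero_of_forall_smul_smul_eq_zero (c := (n : k)) (by exact_mod_cast hn)
      (exists_smul_polytabloid p) ?_) g
  · obtain ⟨c, hc⟩ := exists_columnAntisymmetrizer_smul_eq (s : PermModule k p)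
    exact ⟨c, Subtype.ext hc⟩
  · apply Subtype.ext
    change columnAntisymmetrizer k p • columnAntisymmetrizer k p • tabloid k p =
      (n : k) • columnAntisymmetrizer k p • tabloid k p
    rw [smul_smul, h, smul_assoc]

theorem exists_smul_specht_eq_single [CharZero k] (p : Nat.Partition d)
    (g : Module.End k (Specht k p)) :
    ∃ x : MonoidAlgebra k (Equiv.Perm (Fin d)), (∀ s : Specht k p, x • s = g s) ∧
      ∀ q : Nat.Partition d, q ≠ p → ∀ s : Specht k q, x • s = 0 :=
  exists_smul_eq_single (r := Dominates) (fun _ _ _ => Dominates.trans)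
    (fun _ _ => Dominates.antisymm)
    (fun _ _ h s => Subtype.ext (columnAntisymmetrizer_smul_of_not_dominates h s.1))
    exists_mem_idealSpan_specht p g

theorem eq_zero_of_forall_smul_specht_eq_zero [CharZero k]
    {x : MonoidAlgebra k (Equiv.Perm (Fin d))}
    (hx : ∀ (p : Nat.Partition d) (s : Specht k p), x • s = 0) : x = 0 := by
  have : ∀ p : Nat.Partition d, Nontrivial (Specht k p) := nontrivial_specht
  -- Cycle types label the conjugacy classes, so partitions index both the classes and the Specht
  -- modules.
  exact eq_zero_of_forall_smul_eq_zero (Equiv.Perm.partition (α := Fin d))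
    (fun g h => Equiv.Perm.partition_eq_of_isConj.2) (by rw [Fintype.card_fin])
    exists_smul_specht_eq_single hx

theorem eq_of_forall_smul_specht_eq [CharZero k] {x y : MonoidAlgebra k (Equiv.Perm (Fin d))}
    (h : ∀ (p : Nat.Partition d) (s : Specht k p), x • s = y • s) : x = y :=
  sub_eq_zero.1 <| eq_zero_of_forall_smul_specht_eq_zero fun p s =>
    (sub_smul x y s).trans (sub_eq_zero.2 (h p s))

/-- An element that kills all Specht modules `S^p` with `p ⊵ q` kills `M^q`. -/
theorem mem_annihilator_of_forall_specht [CharZero k] {q : Nat.Partition d}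
    {x : MonoidAlgebra k (Equiv.Perm (Fin d))}
    (hx : ∀ p : Nat.Partition d, Dominates p q → ∀ s : Specht k p, x • s = 0) :
    x ∈ Module.annihilator (MonoidAlgebra k (Equiv.Perm (Fin d))) (PermModule k q) := by
  classical
  choose u hu hu' using fun p : Nat.Partition d => exists_smul_specht_eq_single (k := k) p 1
  choose y hy hy' using fun p : Nat.Partition d => exists_mem_idealSpan_specht (k := k) p 1
  -- The `u p` are the block idempotents. For `p ⊵ q` the block component `u p * x` vanishes; for
  -- other `p`, `u p` factors through the ideal of `κ_p`, which kills `M^q`.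
  have hsum : ∑ p, u p = 1 := eq_of_forall_smul_specht_eq fun p s => by
    rw [Finset.sum_smul, Finset.sum_eq_single p (fun q _ hq => hu' q p hq.symm s) (by simp), hu]
    simp
  rw [Module.mem_annihilator]
  intro m
  rw [← one_mul x, ← hsum, Finset.sum_mul, Finset.sum_smul]
  refine Finset.sum_eq_zero fun p _ => ?_
  by_cases hp : Dominates p q
  · have h0 : u p * x = 0 := eq_zero_of_forall_smul_specht_eq_zero fun l s => by
      by_cases hl : l = p
      · subst hl; rw [mul_smul, hx _ hp, smul_zero]
      · rw [mul_smul, hu' p l hl]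
    rw [h0, zero_smul]
  · have h0 : u p = u p * y p := eq_of_forall_smul_specht_eq fun l s => by
      by_cases hl : l = p
      · subst hl; rw [mul_smul, hy']; rfl
      · rw [mul_smul, hu' p l hl, hu' p l hl]
    rw [h0, mul_smul, mul_smul, smul_eq_zero_of_mem_idealSpan (k := k)
      (columnAntisymmetrizer_smul_of_not_dominates hp) (hy p), smul_zero]

theorem smul_specht_eq_zero_of_mem_annihilator {p : Nat.Partition d}
    {x : MonoidAlgebra k (Equiv.Perm (Fin d))}
    (hx : x ∈ Module.annihilator (MonoidAlgebra k (Equiv.Perm (Fin d))) (PermModule k p))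
    (s : Specht k p) : x • s = 0 :=
  Subtype.ext (Module.mem_annihilator.1 hx s.1)

end Specht

/-! ### Hook partitions -/

section Hook

variable {d r : ℕ}

theorem toComposition_hook_blocks (h : r < d) :
    (toComposition (hook d r h)).blocks = (d - r) :: List.replicate r 1 := by
  change Multiset.sort ((d - r) ::ₘ Multiset.replicate r 1) (· ≥ ·) = _
  rw [Multiset.sort_cons]
  · congr 1
    rw [List.eq_replicate_iff]
    refine ⟨by simp, fun b hb => ?_⟩
    exact Multiset.eq_of_mem_replicate ((Multiset.mem_sort _).1 hb)
  · intro b hb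
    rw [Multiset.eq_of_mem_replicate hb]
    omega

theorem sizeUpTo_hook (h : r < d) (i : ℕ) :
    (toComposition (hook d r h)).sizeUpTo (i + 1) = d - r + min i r := by
  rw [Composition.sizeUpTo, toComposition_hook_blocks]
  simp

/-- Truncated subtraction puts the entries below `d - r` in row `0`; each later entry has a row to
itself. -/
theorem row_hook (h : r < d) (j : Fin d) :
    row (toComposition (hook d r h)) j = (j : ℕ) + 1 - (d - r) := by
  have key := fun i => (row_lt_iff (toComposition (hook d r h)) j (i + 1))
  simp only [sizeUpTo_hook] at key
  have hj := j.2
  rcases hrow : row (toComposition (hook d r h)) j with _ | m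
  · have := key 0
    rw [hrow] at this
    omega
  · have h1 := key m
    have h2 := key (m + 1)
    rw [hrow] at h1 h2
    omega

theorem mem_youngSubgroup_hook_iff (h : r < d) (w : Equiv.Perm (Fin d)) :
    w ∈ youngSubgroup (toComposition (hook d r h)) ↔ ∀ j : Fin d, d - r ≤ j → w j = j := by
  constructor
  · intro hw j hj
    have := hw j
    rw [row_hook, row_hook] at this
    exact Fin.ext (by omega)
  · intro hw j
    rw [row_hook, row_hook]
    by_cases hj : d - r ≤ j
    · rw [hw j hj]
    · by_cases hwj : d - r ≤ w j
      · rw [w.injective (hw _ hwj)]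
      · omega

theorem youngSubgroup_hook_le {p : Nat.Partition d} {h : r < d} (hp : Dominates p (hook d r h)) :
    youngSubgroup (toComposition (hook d r h)) ≤ youngSubgroup (toComposition p) := by
  intro w hw
  have hw' := (mem_youngSubgroup_hook_iff h w).1 hw
  intro j
  have h1 := hp 1
  rw [sizeUpTo_hook h 0] at h1
  by_cases hj : d - r ≤ j
  · rw [hw' j hj]
  · by_cases hwj : d - r ≤ w j
    · rw [w.injective (hw' _ hwj)]
    · have h2 := (row_lt_iff (toComposition p) j 1).2 (by omega)
      have h3 := (row_lt_iff (toComposition p) (w j) 1).2 (by omega)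
      omega

theorem annihilator_hook_le {k : Type*} [Field k] [CharZero k] {p : Nat.Partition d} {h : r < d}
    (hp : Dominates p (hook d r h)) :
    Module.annihilator (MonoidAlgebra k (Equiv.Perm (Fin d))) (PermModule k (hook d r h)) ≤
      Module.annihilator (MonoidAlgebra k (Equiv.Perm (Fin d))) (PermModule k p) := fun _ hx =>
  (mem_annihilator_iff p).2 (mul_smul_eq_zero_of_mem_annihilator hx fun _ hw =>
    single_smul_tabloid_of_mem (youngSubgroup_hook_le hp hw))

end Hook

/-! ### The kernel of the action on tensor space -/

section Tensor

variable {k V : Type*} [Field k] [AddCommGroup V] [Module k V] {d e : ℕ}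

theorem weylInclusion_castAdd (w : Equiv.Perm (Fin d)) (j : Fin d) :
    weylInclusion d e w (Fin.castAdd e j) = Fin.castAdd e (w j) :=
  Equiv.Perm.viaEmbedding_apply w (Fin.castAddEmb e) j

theorem weylInclusion_of_notMem (w : Equiv.Perm (Fin d)) {j : Fin (d + e)}
    (hj : ∀ i, Fin.castAdd e i ≠ j) : weylInclusion d e w j = j :=
  Equiv.Perm.viaEmbedding_apply_of_notMem w (Fin.castAddEmb e) j fun ⟨i, hi⟩ => hj i hi

/-- The basis of the tensor power given by a basis of `V`. -/
noncomputable abbrev tensorBasis (b : Module.Basis (Fin (d + e)) k V) (r : ℕ) :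
    Module.Basis (Fin r → Fin (d + e)) k (PiTensorProduct k fun _ : Fin r => V) :=
  Basis.piTensorProduct fun _ => b

theorem Phi_single_tensorBasis (b : Module.Basis (Fin (d + e)) k V) (r : ℕ)
    (w : Equiv.Perm (Fin d)) (c : k) (J : Fin r → Fin (d + e)) :
    Phi b r (MonoidAlgebra.single w c) (tensorBasis b r J) =
      c • tensorBasis b r fun i => weylInclusion d e w (J i) := by
  simp only [Phi, Representation.asAlgebraHom_single, tensorBasis, Basis.piTensorProduct_apply,
    LinearMap.smul_apply, MonoidHom.comp_apply]
  congr 1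
  change PiTensorProduct.map _ _ = _
  rw [PiTensorProduct.map_tprod]
  congr 1
  ext i
  exact b.equiv_apply _ _ _

/-- At most `r` of the first `d` indices occur in `J`, so they can be moved injectively among the
last `r` of these points. -/
theorem exists_perm_forall_le {r : ℕ} (hr : r ≤ d) (J : Fin r → Fin (d + e)) :
    ∃ g : Equiv.Perm (Fin d), ∀ j, (∃ i, J i = Fin.castAdd e j) → d - r ≤ (g j : ℕ) := by
  classical
  let T : Finset (Fin d) := Finset.univ.filter fun j => ∃ i, J i = Fin.castAdd e j
  let U : Finset (Fin d) := Finset.univ.filter fun j => d - r ≤ (j : ℕ)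
  have hU : U.card = r := by
    have h1 := Finset.card_filter_add_card_filter_not (s := (Finset.univ : Finset (Fin d)))
      fun j => (j : ℕ) < d - r
    rw [Fin.card_filter_val_lt] at h1
    simp only [not_lt, Finset.card_univ, Fintype.card_fin] at h1
    change _ + U.card = d at h1
    omega
  have hT : T.card ≤ r := by
    calc T.card = (T.image (Fin.castAdd e)).card :=
          (Finset.card_image_of_injective _ (Fin.castAdd_injective d e)).symm
      _ ≤ (Finset.univ.image J).card := by
          refine Finset.card_le_card fun x hx => ?_
          obtain ⟨j, hj, rfl⟩ := Finset.mem_image.1 hx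
          obtain ⟨i, hi⟩ := (Finset.mem_filter.1 hj).2
          exact Finset.mem_image.2 ⟨i, by simp, hi⟩
      _ ≤ r := Finset.card_image_le.trans (by simp)
  obtain ⟨U', hU', hcard⟩ := Finset.exists_subset_card_eq (hT.trans hU.ge)
  let f : {j // j ∈ T} ≃ {j // j ∈ U'} := Finset.equivOfCardEq hcard.symm
  refine ⟨f.extendSubtype, fun j hj => ?_⟩
  have := f.extendSubtype_mem j (by simpa [T] using hj)
  exact (Finset.mem_filter.1 (hU' this)).2

theorem ker_Phi [CharZero k] (b : Module.Basis (Fin (d + e)) k V) {r : ℕ} (h : r < d) :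
    RingHom.ker (Phi b r) =
      Module.annihilator (MonoidAlgebra k (Equiv.Perm (Fin d))) (PermModule k (hook d r h)) := by
  classical
  ext x
  constructor
  · intro hx
    rw [mem_annihilator_iff]
    intro a
    have hxa : Phi b r (x * a) = 0 := by rw [map_mul, (RingHom.mem_ker).1 hx, zero_mul]
    generalize x * a = y at hxa
    rw [smul_tabloid_eq_zero_iff]
    let J : Fin r → Fin (d + e) := fun i => Fin.castAdd e ⟨d - r + i, by omega⟩
    -- The stabilizer of `J` is the hook's Young subgroup, so the coefficient at the translate `g J`
    -- sums `z` over the coset of `g`.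
    have hcoeff : ∀ (g : Equiv.Perm (Fin d)) (z : MonoidAlgebra k (Equiv.Perm (Fin d))),
        (tensorBasis b r).repr (Phi b r z (tensorBasis b r J)) (fun i => weylInclusion d e g (J i)) =
          (z * rowSymmetrizer k (hook d r h)).coeff g := by
      intro g z
      induction z using MonoidAlgebra.induction_linear with
      | zero => simp
      | add y z hy hz =>
        rw [map_add, LinearMap.add_apply, map_add, Finsupp.add_apply, hy, hz, add_mul,
          MonoidAlgebra.coeff_add, Finsupp.add_apply]
      | single w c =>
        rw [Phi_single_tensorBasis, map_smul, Module.Basis.repr_self, Finsupp.smul_apply,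
          Finsupp.single_apply, MonoidAlgebra.coeff_single_mul_apply, smul_eq_mul]
        congr 1
        rw [rowSymmetrizer, MonoidAlgebra.coeff_sum, Finsupp.finsetSum_apply]
        simp only [MonoidAlgebra.coeff_single, Finsupp.single_apply]
        rw [Finset.sum_ite_eq']
        refine if_congr ?_ rfl rfl
        simp only [Finset.mem_filter, Finset.mem_univ, true_and, mem_youngSubgroup_hook_iff,
          Equiv.Perm.mul_apply, Equiv.Perm.inv_eq_iff_eq, J, weylInclusion_castAdd, funext_iff,
          (Fin.castAdd_injective d e).eq_iff]
        constructor
        · intro hw j hj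
          have := hw ⟨j - (d - r), by omega⟩
          have hj' : (⟨d - r + (j - (d - r)), by omega⟩ : Fin d) = j := Fin.ext (by simp; omega)
          simp only [hj'] at this
          exact this.symm
        · intro hw i
          exact (hw _ (by simp)).symm
    ext g
    rw [← hcoeff, hxa]
    simp
  · intro hx
    rw [RingHom.mem_ker]
    refine (tensorBasis b r).ext fun J => ?_
    obtain ⟨g, hg⟩ := exists_perm_forall_le h.le J
    let ρ : Representation k (Equiv.Perm (Fin d)) _ := (tensorRep b r).comp (weylInclusion d e)
    have hsmul : ∀ (a : MonoidAlgebra k (Equiv.Perm (Fin d))) v,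
        ρ.asModuleEquiv (a • ρ.asModuleEquiv.symm v) = Phi b r a v := fun a v => by
      rw [Representation.asModuleEquiv_map_smul, LinearEquiv.apply_symm_apply]
      rfl
    -- The translate `g J` is fixed by the Young subgroup, which moves only the first `d - r`
    -- points; applying `x * g⁻¹` to it gives the action of `x` on `J`.
    have key := mul_smul_eq_zero_of_mem_annihilator hx
      (v := ρ.asModuleEquiv.symm (tensorBasis b r fun i => weylInclusion d e g (J i))) (by
        intro w hw
        rw [mem_youngSubgroup_hook_iff] at hw
        apply ρ.asModuleEquiv.injective
        rw [hsmul, LinearEquiv.apply_symm_apply, Phi_single_tensorBasis, one_smul]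
        congr 1
        ext1 i
        by_cases hi : ∃ j, Fin.castAdd e j = J i
        · obtain ⟨j, hj⟩ := hi
          rw [← hj, weylInclusion_castAdd, weylInclusion_castAdd, hw _ (hg j ⟨i, hj.symm⟩)]
        · push Not at hi
          rw [weylInclusion_of_notMem g hi, weylInclusion_of_notMem w hi])
      (MonoidAlgebra.single g⁻¹ 1)
    have key' := congrArg ρ.asModuleEquiv key
    rw [hsmul, map_mul, Module.End.mul_apply, Phi_single_tensorBasis, one_smul, map_zero] at key'
    rw [LinearMap.zero_apply, ← key']
    congr 2
    ext1 i
    simp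

end Tensor

end SymTensor

theorem mainTheorem5 {k : Type*} [Field k] [CharZero k] (d r e : ℕ) (he : e = 0 ∨ e = 1)
    (hr : 1 ≤ r) (hd : r + 1 < d) {V : Type*} [AddCommGroup V] [Module k V]
    (b : Module.Basis (Fin (d + e)) k V) :
    (∃ f : RingHom.ker (Phi b r) ≃ₗ[k]
        ((p : {p : Nat.Partition d // ¬ Dominates p (hook d r (Nat.lt_of_succ_lt hd))}) →
          Module.End k (Specht k p.1)),
      (∀ x y : RingHom.ker (Phi b r), f (x * y) = f x * f y) ∧
      ∀ (x : RingHom.ker (Phi b r))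
        (p : {p : Nat.Partition d // ¬ Dominates p (hook d r (Nat.lt_of_succ_lt hd))}),
        f x p = spechtAction k p.1 x) ∧
    RingHom.ker (Phi b r) =
      Module.annihilator (MonoidAlgebra k (Equiv.Perm (Fin d)))
        (PermModule k (hook d r (Nat.lt_of_succ_lt hd))) ∧
    Module.annihilator (MonoidAlgebra k (Equiv.Perm (Fin d)))
        (PermModule k (hook d r (Nat.lt_of_succ_lt hd))) =
      ⨅ (p : Nat.Partition d) (_ : Dominates p (hook d r (Nat.lt_of_succ_lt hd))),
        Module.annihilator (MonoidAlgebra k (Equiv.Perm (Fin d))) (PermModule k p) := by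
  classical
  set q := hook d r (Nat.lt_of_succ_lt hd)
  have hker : RingHom.ker (Phi b r) = Module.annihilator (MonoidAlgebra k (Equiv.Perm (Fin d)))
      (PermModule k q) := ker_Phi b _
  refine ⟨?_, hker, le_antisymm (le_iInf₂ fun p hp => annihilator_hook_le hp)
    (iInf₂_le q fun i => le_rfl)⟩
  let F : RingHom.ker (Phi b r) →ₗ[k]
      ((p : {p : Nat.Partition d // ¬ Dominates p q}) → Module.End k (Specht k p.1)) :=
    LinearMap.pi fun p => (spechtAction k p.1).toLinearMap ∘ₗ
      (RingHom.ker (Phi b r)).subtype.restrictScalars k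
  have hzero : ∀ x ∈ RingHom.ker (Phi b r), ∀ p, Dominates p q → ∀ s : Specht k p, x • s = 0 :=
    fun x hx p hp => smul_specht_eq_zero_of_mem_annihilator (annihilator_hook_le hp (hker ▸ hx))
  have hF : Function.Bijective F := by
    constructor
    · rw [injective_iff_map_eq_zero]
      intro x hx
      refine Subtype.ext (eq_zero_of_forall_smul_specht_eq_zero fun p s => ?_)
      by_cases hp : Dominates p q
      · exact hzero _ x.2 p hp s
      · exact LinearMap.congr_fun (congrFun hx ⟨p, hp⟩) s
    · intro g
      choose u hu hu' using fun p : {p : Nat.Partition d // ¬ Dominates p q} =>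
        exists_smul_specht_eq_single p.1 (g p)
      -- The sum vanishes on every `S^p` with `p` dominating the hook, hence lies in the kernel, and
      -- has the prescribed action on each other block.
      refine ⟨⟨∑ p, u p, ?_⟩, ?_⟩
      · rw [hker]
        refine mem_annihilator_of_forall_specht fun p hp s => ?_
        rw [Finset.sum_smul]
        refine Finset.sum_eq_zero fun l _ => hu' l p ?_ s
        rintro rfl
        exact l.2 hp
      · ext p s : 2
        change (∑ l, u l) • s = g p s
        rw [Finset.sum_smul, Finset.sum_eq_single p (fun l _ hl => hu' l p.1
          (fun h => hl (Subtype.ext h.symm)) s) (by simp), hu]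
  refine ⟨LinearEquiv.ofBijective F hF, fun x y => ?_, fun x p => rfl⟩
  ext1 p
  exact map_mul (spechtAction k p.1) x.1 y.1
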